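/- Let $G$ be a discrete group, with counting measure, and write $\ell^p(G)$ for the complex $\ell^p$-spaces. On $\ell^2(G)$ let $(\lambda_s f)(t)=f(s^{-1}t)$ be the left regular representation, $M_a$ ($a\in\ell^\infty(G)$) the multiplication operators, and $VN(G)=\overline{\operatorname{span}}^{\,w^*}\{\lambda_s : s\in G\}\subseteq \mathcal B(\ell^2(G))$ the group von Neumann algebra. Let $A(G)$ be the Fourier algebra, i.e. the set of functions $x\mapsto(\lambda_x\xi,\eta)$ with $\xi,\eta\in\ell^2(G)$; it is the predual of $VN(G)$ through $\langle T,v\rangle=(T\xi,\eta)$ for $v(x)=(\lambda_x\xi,\eta)$. If $u:G\to\mathbb C$ is a multiplier of $A(G)$ (that is, $uA(G)\subseteq A(G)$), then $\|u\|_{mcb}$ denotes the completely bounded norm of the dual $VN(G)\to VN(G)$ of the map $v\mapsto uv$ on $A(G)$. The group $G$ is *weakly amenable* if there are a constant $L>0$ and a net $(u_i)$ of finitely supported elements of $A(G)$ with $\|u_i\|_{mcb}\le L$ for all $i$ and $u_i(s)\to 1$ for every $s\in G$. Let $\mathcal T(G)$ be the predual of $\mathcal B(\ell^2(G))$, realized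 as the space of functions $h(x,y)=\sum_{i=1}^\infty f_i(x)g_i(y)$ on $G\times G$ with $f_i,g_i\in\ell^2(G)$, $\sum_i\|f_i\|_2^2<\infty$ and $\sum_i\|g_i\|_2^2<\infty$, with norm $\|h\|_t=\inf\sum_i\|f_i\|_2\|g_i\|_2$ (the infimum is over all such representations of $h$) and pairing $\langle T,h\rangle_t=\sum_i(Tf_i,\overline{g_i})$. For $f\in\ell^1(G)$ and $h\in\mathcal T(G)$ put $\theta(f)(h)(s,t)=\sum_{r\in G}f(r)\,h(sr^{-1},tr^{-1})$. For a closed left ideal $J$ of the convolution algebra $\ell^1(G)$ let $$J^\perp=\Big\{a\in\ell^\infty(G):\ \sum_{x\in G}a(x)f(x)=0\ \text{ for all } f\in J\Big\},\qquad \operatorname{Ran}J=\overline{\operatorname{span}}^{\,\|\cdot\|_t}\{\theta(f)(h): f\in J,\ h\in\mathcal T(G)\}\subseteq\mathcal T(G),$$ let $(\operatorname{Ran}J)^\perp$ be the annihilator of $\operatorname{Ran}J$ in $\mathcal B(\ell^2(G))$, and let $$\operatorname{Bim}(J^\perp)=\overline{\operatorname{span}}^{\,w^*}\{AM_aB:\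 A,B\in VN(G),\ a\in J^\perp\}\subseteq\mathcal B(\ell^2(G)).$$ **Proposition.** If $G$ is a weakly amenable discrete group, then for every closed left ideal $J\subseteq\ell^1(G)$, $$(\operatorname{Ran}J)^\perp=\operatorname{Bim}(J^\perp).$$ -/

import Mathlib

open scoped ENNReal Topology

noncomputable section

namespace VNBimodule

universe u

/-- `ℓ¹(G) = L¹(G)` for the discrete group `G` with counting measure. -/
abbrev Ell1 (G : Type u) := lp (fun _ : G => ℂ) 1

/-- `ℓ²(G) = L²(G)`. -/
abbrev Ell2 (G : Type u) := lp (fun _ : G => ℂ) 2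

/-- `ℓ^∞(G) = L^∞(G)`. -/
abbrev EllInf (G : Type u) := lp (fun _ : G => ℂ) ∞

/-- The bounded operators on `ℓ²(G)`. -/
abbrev BEll2 (G : Type u) := Ell2 G →L[ℂ] Ell2 G

/-! ### Operators on `ℓ²(G)` -/

section Operators

variable {G : Type u}

/-- The isometry `f ↦ f ∘ e` of `ℓ²(G)` given by a permutation `e` of `G`. -/
def reindex (e : Equiv.Perm G) : Ell2 G →ₗᵢ[ℂ] Ell2 G where
  toFun f := ⟨fun t => f (e t), memℓp_gen (by
    have h := (lp.memℓp f).summable (by norm_num)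
    exact h.comp_injective e.injective)⟩
  map_add' _ _ := rfl
  map_smul' _ _ := rfl
  norm_map' f := by
    rw [lp.norm_eq_tsum_rpow (by norm_num), lp.norm_eq_tsum_rpow (by norm_num)]
    congr 1
    exact e.tsum_eq (fun t => ‖f t‖ ^ (2 : ℝ≥0∞).toReal)

@[simp] theorem reindex_apply (e : Equiv.Perm G) (f : Ell2 G) (t : G) :
    reindex e f t = f (e t) := rfl

/-- The multiplication operator `M_a` on `ℓ²(G)`, `(M_a f)(t) = a(t) f(t)`. -/
def mulOp (a : EllInf G) : BEll2 G :=
  lp.mapCLM 2 (fun t => a t • ContinuousLinearMap.id ℂ ℂ) (norm_nonneg a) (fun t => by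
    rw [norm_smul]
    exact (mul_le_of_le_one_right (norm_nonneg _) ContinuousLinearMap.norm_id_le).trans
      (lp.norm_apply_le_norm (by simp) a t))

@[simp] theorem mulOp_apply (a : EllInf G) (f : Ell2 G) (t : G) :
    mulOp a f t = a t * f t := by
  simp [mulOp]

variable [Group G]

/-- The left regular representation, `(λ_s f)(t) = f(s⁻¹ t)`. -/
def leftReg (s : G) : BEll2 G := (reindex (Equiv.mulLeft s⁻¹)).toContinuousLinearMap

@[simp] theorem leftReg_apply (s : G) (f : Ell2 G) (t : G) :
    leftReg s f t = f (s⁻¹ * t) := rfl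

end Operators

/-! ### The predual `T(G)` of `B(ℓ²(G))` as a space of functions on `G × G` -/

section TraceClass

variable {G : Type u}

/-- `h(x,y) = ∑ i, f_i(x) g_i(y)` with `∑ ‖f_i‖² < ∞` and `∑ ‖g_i‖² < ∞`. -/
structure IsRep {ι : Type*} (h : G → G → ℂ) (f g : ι → Ell2 G) : Prop where
  summable_left : Summable fun i => ‖f i‖ ^ 2
  summable_right : Summable fun i => ‖g i‖ ^ 2
  hasSum : ∀ x y, HasSum (fun i => f i x * g i y) (h x y)

/-- A representation over any index set can be rewritten as one over `ℕ`. -/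
theorem IsRep.exists_nat {ι : Type*} {h : G → G → ℂ} {f g : ι → Ell2 G} (H : IsRep h f g) :
    ∃ f' g' : ℕ → Ell2 G, IsRep h f' g' := by
  set s : Set ι := Function.support (fun i => ‖f i‖ ^ 2) with hs
  have hc : s.Countable := H.summable_left.countable_support
  have : Countable s := hc
  obtain ⟨e, he⟩ := Countable.exists_injective_nat s
  have hz : ∀ (k : s → Ell2 G) (n : ℕ), n ∉ Set.range e → Function.extend e k 0 n = 0 := by
    intro k n hn
    rw [Function.extend_apply' _ _ _ (by simpa using hn)]
    rfl
  refine ⟨Function.extend e (fun i : s => f i) 0, Function.extend e (fun i : s => g i) 0,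
    ?_, ?_, ?_⟩
  · rw [← he.summable_iff (fun n hn => by simp [hz _ n hn])]
    simp only [Function.comp_def, he.extend_apply]
    exact H.summable_left.subtype s
  · rw [← he.summable_iff (fun n hn => by simp [hz _ n hn])]
    simp only [Function.comp_def, he.extend_apply]
    exact H.summable_right.subtype s
  · intro x y
    rw [← he.hasSum_iff (fun n hn => by simp [hz _ n hn])]
    have := (hasSum_subtype_iff_of_support_subset (s := s) (f := fun i => f i x * g i y)
      (a := h x y) (by
        intro i hi
        by_contra hi'
        apply hi
        have : f i = 0 := by simpa [hs] using hi'
        simp [this])).2 (H.hasSum x y)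
    simpa [Function.comp_def, he.extend_apply] using this

variable (G) in
/-- The space `T(G)`. -/
def traceClass : Submodule ℂ (G → G → ℂ) where
  carrier := {h | ∃ f g : ℕ → Ell2 G, IsRep h f g}
  zero_mem' := ⟨0, 0, by simp, by simp, fun x y => by simp⟩
  add_mem' := by
    rintro h k ⟨f, g, H⟩ ⟨f', g', H'⟩
    refine IsRep.exists_nat (ι := ℕ ⊕ ℕ) (f := Sum.elim f f') (g := Sum.elim g g') ⟨?_, ?_, ?_⟩
    · exact (H.summable_left.hasSum.sum (f := fun i => ‖Sum.elim f f' i‖ ^ 2)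
        H'.summable_left.hasSum).summable
    · exact (H.summable_right.hasSum.sum (f := fun i => ‖Sum.elim g g' i‖ ^ 2)
        H'.summable_right.hasSum).summable
    · intro x y
      exact (H.hasSum x y).sum (f := fun i => Sum.elim f f' i x * Sum.elim g g' i y)
        (H'.hasSum x y)
  smul_mem' := by
    rintro c h ⟨f, g, H⟩
    refine ⟨fun i => c • f i, g, ?_, H.summable_right, fun x y => ?_⟩
    · simpa [norm_smul, mul_pow] using H.summable_left.mul_left (‖c‖ ^ 2)
    · simpa [mul_assoc] using (H.hasSum x y).mul_left c

/-- The norm `‖h‖_t = inf ∑ ‖f_i‖ ‖g_i‖` of `T(G)`, over all representations of `h`. -/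
def traceNorm (h : traceClass G) : ℝ :=
  sInf {c | ∃ f g : ℕ → Ell2 G, IsRep (h : G → G → ℂ) f g ∧ c = ∑' i, ‖f i‖ * ‖g i‖}

/-- The pairing `⟨T, h⟩_t = ∑ i, (T f_i, conj g_i)` of `B(ℓ²(G))` with `T(G)`; by
`hasSum_tracePairing` below it does not depend on the representation of `h`. -/
def tracePairing (T : BEll2 G) (h : traceClass G) : ℂ :=
  ∑' i, inner ℂ (star (h.2.choose_spec.choose i)) (T (h.2.choose i))

/-- Truncation of a vector of `ℓ²(G)` to a finite set. -/
theorem inner_trunc [DecidableEq G] (T : BEll2 G) (a b : Ell2 G) (F : Finset G) :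
    inner ℂ (star (∑ y ∈ F, lp.single 2 y (b y))) (T (∑ x ∈ F, lp.single 2 x (a x))) =
      ∑ x ∈ F, ∑ y ∈ F, a x * b y * T (lp.single 2 x 1) y := by
  have h1 : ∀ (y : G) (v : Ell2 G),
      inner ℂ (star (lp.single 2 y (b y) : Ell2 G)) v = b y * v y := by
    intro y v
    have : star (lp.single 2 y (b y) : Ell2 G) = lp.single 2 y (star (b y)) := by
      ext z
      rcases eq_or_ne z y with rfl | hz
      · simp
      · simp [hz]
    rw [this, lp.inner_single_left]
    simp [mul_comm]
  have h2 : ∀ x : G, (lp.single 2 x (a x) : Ell2 G) = a x • lp.single 2 x (1 : ℂ) := by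
    intro x
    rw [← lp.single_smul]
    simp
  rw [star_sum, sum_inner, Finset.sum_comm]
  refine Finset.sum_congr rfl fun y _ => ?_
  rw [h1, map_sum]
  have : (⇑(∑ x ∈ F, T (lp.single 2 x (a x)))) y = ∑ x ∈ F, T (lp.single 2 x (a x)) y := by
    rw [lp.coeFn_sum]; simp
  rw [this, Finset.mul_sum]
  refine Finset.sum_congr rfl fun x _ => ?_
  rw [h2, map_smul]
  simp only [lp.coeFn_smul, Pi.smul_apply, smul_eq_mul]
  ring

theorem norm_trunc_le [DecidableEq G] (a : Ell2 G) (F : Finset G) :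
    ‖∑ x ∈ F, (lp.single 2 x (a x) : Ell2 G)‖ ≤ ‖a‖ := by
  have h1 := lp.norm_sum_single (p := 2) (by norm_num) (fun x => a x) F
  have h2 := lp.sum_rpow_le_norm_rpow (p := 2) (by norm_num) a F
  rw [← h1] at h2
  exact (Real.rpow_le_rpow_iff (norm_nonneg _) (norm_nonneg _) (by norm_num)).1 h2

theorem IsRep.summable_mul {ι : Type*} {h : G → G → ℂ} {f g : ι → Ell2 G} (H : IsRep h f g) :
    Summable fun i => ‖f i‖ * ‖g i‖ :=
  Summable.of_nonneg_of_le (fun i => by positivity)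
    (fun i => by nlinarith [sq_nonneg (‖f i‖ - ‖g i‖), sq_nonneg ‖f i‖, sq_nonneg ‖g i‖])
    (H.summable_left.add H.summable_right)

theorem norm_star_inner_le (T : BEll2 G) (a b : Ell2 G) :
    ‖inner ℂ (star b) (T a)‖ ≤ ‖T‖ * (‖a‖ * ‖b‖) := by
  refine (norm_inner_le_norm _ _).trans ?_
  rw [norm_star]
  nlinarith [T.le_opNorm a, norm_nonneg b, norm_nonneg (T a)]

theorem IsRep.tendsto_trunc [DecidableEq G] {ι : Type*} {h : G → G → ℂ} {f g : ι → Ell2 G}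
    (H : IsRep h f g) (T : BEll2 G) :
    Filter.Tendsto (fun F : Finset G => ∑ x ∈ F, ∑ y ∈ F, h x y * T (lp.single 2 x 1) y)
      Filter.atTop (𝓝 (∑' i, inner ℂ (star (g i)) (T (f i)))) := by
  have key : ∀ F : Finset G, ∑ x ∈ F, ∑ y ∈ F, h x y * T (lp.single 2 x 1) y =
      ∑' i, inner ℂ (star (∑ y ∈ F, lp.single 2 y (g i y)))
        (T (∑ x ∈ F, lp.single 2 x (f i x))) := by
    intro F
    simp only [inner_trunc]
    exact (hasSum_sum fun x _ => hasSum_sum fun y _ => (H.hasSum x y).mul_right _).tsum_eq.symm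
  simp only [key]
  refine tendsto_tsum_of_dominated_convergence (bound := fun i => ‖T‖ * (‖f i‖ * ‖g i‖))
    (H.summable_mul.mul_left _) (fun i => ?_) (Filter.Eventually.of_forall fun F i => ?_)
  · have hf : Filter.Tendsto (fun F : Finset G => ∑ x ∈ F, (lp.single 2 x (f i x) : Ell2 G))
        Filter.atTop (𝓝 (f i)) := lp.hasSum_single (by simp) (f i)
    have hg : Filter.Tendsto (fun F : Finset G => ∑ x ∈ F, (lp.single 2 x (g i x) : Ell2 G))
        Filter.atTop (𝓝 (g i)) := lp.hasSum_single (by simp) (g i)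
    exact (((continuous_star.tendsto _).comp hg)).inner ((T.continuous.tendsto _).comp hf)
  · refine (norm_star_inner_le _ _ _).trans ?_
    gcongr
    · exact norm_trunc_le _ _
    · exact norm_trunc_le _ _

/-- The pairing can be computed from any representation, over any index set. -/
theorem hasSum_tracePairing {ι : Type*} (T : BEll2 G) (h : traceClass G) {f g : ι → Ell2 G}
    (H : IsRep (h : G → G → ℂ) f g) :
    HasSum (fun i => inner ℂ (star (g i)) (T (f i))) (tracePairing T h) := by
  classical
  have hs : Summable fun i => inner ℂ (star (g i)) (T (f i)) :=
    Summable.of_norm_bounded (H.summable_mul.mul_left ‖T‖) fun i => norm_star_inner_le _ _ _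
  have := tendsto_nhds_unique (H.tendsto_trunc T) (h.2.choose_spec.choose_spec.tendsto_trunc T)
  rw [tracePairing, ← this]
  exact hs.hasSum

theorem tracePairing_add (S T : BEll2 G) (h : traceClass G) :
    tracePairing (S + T) h = tracePairing S h + tracePairing T h := by
  obtain ⟨f, g, H⟩ := h.2
  refine (hasSum_tracePairing _ h H).unique ?_
  simpa [inner_add_right] using (hasSum_tracePairing S h H).add (hasSum_tracePairing T h H)

theorem tracePairing_smul (c : ℂ) (T : BEll2 G) (h : traceClass G) :
    tracePairing (c • T) h = c * tracePairing T h := by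
  obtain ⟨f, g, H⟩ := h.2
  refine (hasSum_tracePairing _ h H).unique ?_
  simpa [inner_smul_right] using (hasSum_tracePairing T h H).mul_left c

/-- The operator `T` as a functional on `T(G)`. -/
def tracePairingₗ : BEll2 G →ₗ[ℂ] (traceClass G → ℂ) where
  toFun T h := tracePairing T h
  map_add' S T := funext fun h => tracePairing_add S T h
  map_smul' c T := funext fun h => tracePairing_smul c T h

variable (G) in
/-- The weak-* topology of `B(ℓ²(G)) = T(G)*`: the coarsest topology making
`T ↦ ⟨T, h⟩_t` continuous for every `h ∈ T(G)`. -/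
@[reducible] def weakStarTopology : TopologicalSpace (BEll2 G) :=
  TopologicalSpace.induced (fun T (h : traceClass G) => tracePairing T h) inferInstance

/-- The weak-* closure of a linear subspace of `B(ℓ²(G))`. -/
def weakStarClosure (S : Submodule ℂ (BEll2 G)) : Submodule ℂ (BEll2 G) :=
  haveI : @ContinuousAdd (BEll2 G) (weakStarTopology G) _ :=
    continuousAdd_induced (tracePairingₗ (G := G))
  haveI : @ContinuousConstSMul ℂ (BEll2 G) (weakStarTopology G) _ :=
    letI := weakStarTopology G
    Topology.IsInducing.continuousConstSMul (f := id) (g := tracePairingₗ (G := G)) ⟨rfl⟩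
      (fun {c T} => map_smul tracePairingₗ c T)
  @Submodule.topologicalClosure ℂ (BEll2 G) _ (weakStarTopology G) _ _ _ _ S

@[simp] theorem coe_weakStarClosure (S : Submodule ℂ (BEll2 G)) :
    (weakStarClosure S : Set (BEll2 G)) =
      @closure (BEll2 G) (weakStarTopology G) (S : Set (BEll2 G)) := rfl

end TraceClass

section Group

variable {G : Type u} [Group G]

/-! ### The map `θ(f)` on `T(G)` -/

theorem thetaFun_mem (f : Ell1 G) (h : traceClass G) :
    (fun s t : G => ∑' r, f r * (h : G → G → ℂ) (s * r⁻¹) (t * r⁻¹)) ∈ traceClass G := by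
  obtain ⟨a, b, H⟩ := h.2
  have hc : ∀ r, ∃ c : ℂ, c ^ 2 = f r := fun r => IsAlgClosed.exists_pow_nat_eq _ (by norm_num)
  choose c hc using hc
  have hn : ∀ r, ‖c r‖ ^ 2 = ‖f r‖ := fun r => by rw [← norm_pow, hc]
  have hf : Summable fun r => ‖f r‖ := by
    simpa using (lp.memℓp f).summable (by norm_num)
  have hsq : ∀ k : ℕ → Ell2 G, (Summable fun i => ‖k i‖ ^ 2) →
      Summable fun p : G × ℕ => ‖c p.1 • reindex (Equiv.mulRight p.1⁻¹) (k p.2)‖ ^ 2 := by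
    intro k hk
    simp only [norm_smul, mul_pow, hn, LinearIsometry.norm_map]
    exact Summable.mul_of_nonneg (f := fun r => ‖f r‖) (g := fun i => ‖k i‖ ^ 2) hf hk
      (fun _ => norm_nonneg _) (fun _ => by positivity)
  refine IsRep.exists_nat (ι := G × ℕ)
    (f := fun p => c p.1 • reindex (Equiv.mulRight p.1⁻¹) (a p.2))
    (g := fun p => c p.1 • reindex (Equiv.mulRight p.1⁻¹) (b p.2))
    ⟨hsq a H.summable_left, hsq b H.summable_right, fun s t => ?_⟩
  have hab : ∀ (k : Ell2 G) (x : G), ‖k x‖ ≤ ‖k‖ := fun k x =>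
    lp.norm_apply_le_norm (by norm_num) k x
  have hsum : Summable fun p : G × ℕ => f p.1 * (a p.2 (s * p.1⁻¹) * b p.2 (t * p.1⁻¹)) := by
    refine Summable.of_norm_bounded
      (Summable.mul_of_nonneg (f := fun r => ‖f r‖) (g := fun i => ‖a i‖ * ‖b i‖)
        hf H.summable_mul (fun _ => norm_nonneg _) (fun _ => by positivity)) ?_
    rintro ⟨r, i⟩
    simp only [norm_mul]
    gcongr
    · exact hab _ _
    · exact hab _ _
  have h1 : ∀ r, HasSum (fun i => f r * (a i (s * r⁻¹) * b i (t * r⁻¹)))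
      (f r * (h : G → G → ℂ) (s * r⁻¹) (t * r⁻¹)) := fun r => (H.hasSum _ _).mul_left _
  have h2 := hsum.hasSum.prod_fiberwise h1
  rw [h2.tsum_eq]
  convert hsum.hasSum using 2 with p
  simp only [lp.coeFn_smul, Pi.smul_apply, reindex_apply, Equiv.coe_mulRight, smul_eq_mul]
  rw [← hc]
  ring

/-- The map `θ(f)(h) = ∑ r, f(r) h_{r⁻¹}` on `T(G)`, where `h_r(s,t) = h(sr,tr)`. -/
def theta (f : Ell1 G) (h : traceClass G) : traceClass G :=
  ⟨fun s t => ∑' r, f r * (h : G → G → ℂ) (s * r⁻¹) (t * r⁻¹), thetaFun_mem f h⟩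

/-! ### Ideals of `ℓ¹(G)`, `Ran J`, and annihilators -/

theorem memℓp_conv (g f : Ell1 G) : Memℓp (fun y : G => ∑' x, g x * f (x⁻¹ * y)) 1 := by
  have hg : Summable fun r => ‖g r‖ := by simpa using (lp.memℓp g).summable (by norm_num)
  have hf : Summable fun r => ‖f r‖ := by simpa using (lp.memℓp f).summable (by norm_num)
  have h1 : Summable fun p : G × G => ‖g p.1‖ * ‖f p.2‖ :=
    hg.mul_of_nonneg hf (fun _ => norm_nonneg _) (fun _ => norm_nonneg _)
  let e : G × G ≃ G × G :=
    { toFun := fun p => (p.2, p.2⁻¹ * p.1)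
      invFun := fun p => (p.1 * p.2, p.1)
      left_inv := fun p => by simp
      right_inv := fun p => by simp }
  have h2 : Summable fun p : G × G => ‖g p.2 * f (p.2⁻¹ * p.1)‖ := by
    simpa [e, Function.comp_def] using (e.summable_iff).2 h1
  apply memℓp_gen
  simp only [ENNReal.toReal_one, Real.rpow_one]
  exact Summable.of_nonneg_of_le (fun _ => norm_nonneg _)
    (fun y => norm_tsum_le_tsum_norm (h2.prod_factor y)) h2.prod

/-- Convolution on `ℓ¹(G)`, `(g * f)(y) = ∑ x, g(x) f(x⁻¹ y)`. -/
def conv (g f : Ell1 G) : Ell1 G := ⟨fun y => ∑' x, g x * f (x⁻¹ * y), memℓp_conv g f⟩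

/-- `J` is a closed left ideal of the convolution algebra `ℓ¹(G)`. -/
structure IsClosedLeftIdeal (J : Submodule ℂ (Ell1 G)) : Prop where
  isClosed : IsClosed (J : Set (Ell1 G))
  conv_mem : ∀ g f : Ell1 G, f ∈ J → conv g f ∈ J

/-- The annihilator `J^⊥` of `J ⊆ ℓ¹(G)` in `ℓ^∞(G)`, for the duality `⟨a, f⟩ = ∑ x, a(x) f(x)`. -/
def annihilator (J : Submodule ℂ (Ell1 G)) : Set (EllInf G) :=
  {a | ∀ f ∈ J, ∑' x, a x * f x = 0}

/-- `Ran J`, the `‖·‖_t`-closed linear span in `T(G)` of the `θ(f)(h)`, `f ∈ J`, `h ∈ T(G)`. -/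
def ran (J : Submodule ℂ (Ell1 G)) : Set (traceClass G) :=
  {k | ∀ ε > 0, ∃ k' ∈ Submodule.span ℂ {k' | ∃ f ∈ J, ∃ h, k' = theta f h},
    traceNorm (k - k') < ε}

/-- The annihilator in `B(ℓ²(G))` of a subset of `T(G)`. -/
def traceAnnihilator (R : Set (traceClass G)) : Set (BEll2 G) :=
  {T | ∀ h ∈ R, tracePairing T h = 0}

/-! ### The group von Neumann algebra and its bimodules -/

variable (G) in
/-- The group von Neumann algebra, the weak-* closed linear span of the `λ_x`. -/
def vN : Submodule ℂ (BEll2 G) := weakStarClosure (Submodule.span ℂ (Set.range leftReg))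

/-- `Bim(U)`, the weak-* closed linear span of the `A M_a B` with `A, B ∈ VN(G)`, `a ∈ U`. -/
def bim (U : Set (EllInf G)) : Submodule ℂ (BEll2 G) :=
  weakStarClosure (Submodule.span ℂ
    {T | ∃ A ∈ vN G, ∃ a ∈ U, ∃ B ∈ vN G, T = A * mulOp a * B})

/-! ### Multipliers of the Fourier algebra and weak amenability -/

/-- The coefficient function `x ↦ (λ_x ξ, η)` of the left regular representation. -/
def coeff (ξ η : Ell2 G) : G → ℂ := fun x => inner ℂ η (leftReg x ξ)

variable (G) in
/-- The Fourier algebra `A(G)`. -/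
def fourierAlgebra : Set (G → ℂ) := {v | ∃ ξ η : Ell2 G, v = coeff ξ η}

/-- `u` is a multiplier of `A(G)`. -/
def IsMultiplier (u : G → ℂ) : Prop := ∀ v ∈ fourierAlgebra G, u * v ∈ fourierAlgebra G

/-- `Φ : VN(G) → VN(G)` is the dual `m_u^*` of `m_u : v ↦ u v` on `A(G)`, i.e.
`⟨Φ T, v⟩ = ⟨T, u v⟩`, where `⟨T, v⟩ = (T ξ, η)` if `v(x) = (λ_x ξ, η)`. -/
def IsMultiplierDual (u : G → ℂ) (Φ : vN G →ₗ[ℂ] vN G) : Prop :=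
  ∀ (T : vN G) (ξ η ξ' η' : Ell2 G), coeff ξ' η' = u * coeff ξ η →
    inner ℂ η ((Φ T : BEll2 G) ξ) = inner ℂ η' ((T : BEll2 G) ξ')

/-- A matrix over `VN(G)`, as an element of the C*-algebra `M_n(B(ℓ²(G)))`. -/
def toCStarMatrix {n : ℕ} (A : Matrix (Fin n) (Fin n) (vN G)) :
    CStarMatrix (Fin n) (Fin n) (BEll2 G) :=
  CStarMatrix.ofMatrix (A.map fun T => (T : BEll2 G))

/-- The completely bounded norm of `Φ` is at most `L`. -/
def CBNormLE (Φ : vN G →ₗ[ℂ] vN G) (L : ℝ) : Prop :=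
  ∀ (n : ℕ) (A : Matrix (Fin n) (Fin n) (vN G)),
    ‖toCStarMatrix (A.map Φ)‖ ≤ L * ‖toCStarMatrix A‖

/-- `u` is a completely bounded multiplier of `A(G)` with `‖u‖_mcb ≤ L`. -/
def McbNormLE (u : G → ℂ) (L : ℝ) : Prop :=
  IsMultiplier u ∧ ∃ Φ : vN G →ₗ[ℂ] vN G, IsMultiplierDual u Φ ∧ CBNormLE Φ L

variable (G) in
/-- Weak amenability of the discrete group `G`: there is a net of finitely supported elements of
`A(G)`, bounded in the norm `‖·‖_mcb`, that converges pointwise to `1`. -/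
def WeaklyAmenable : Prop :=
  ∃ (ι : Type u) (_ : Preorder ι) (_ : IsDirectedOrder ι) (_ : Nonempty ι) (u : ι → G → ℂ)
    (L : ℝ), 0 < L ∧
      (∀ i, u i ∈ fourierAlgebra G ∧ (Function.support (u i)).Finite ∧ McbNormLE (u i) L) ∧
      ∀ s, Filter.Tendsto (fun i => u i s) Filter.atTop (𝓝 1)

end Group

end VNBimodule

end

/-! Write `T_g(x)` for the matrix entry of `T` at column `x`, row `gx`. Formally `T = ∑ g, λ_g
M_{T_g}`, and the proof compares this expansion with both sides.

If `T` annihilates `Ran J`, pairing `T` with `θ(f)(δ_1 ⊗ δ_g)` shows that every `T_g` lies in `J^⊥`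
(`diagonal_mem_annihilator`). The expansion need not converge, so it is damped by the net `u_i`: the
finite sum `∑ g, u_i(g) λ_g M_{T_g}` lies in the span defining `Bim(J^⊥)`, and its matrix is that of
`T` multiplied entrywise by `u_i(y x⁻¹)`. By `McbNormLE.norm_le` these sums are bounded by `L ‖T‖`.
Their entries converge to those of `T`, and for bounded nets this is weak-* convergence
(`tendsto_tracePairing_of_bounded`).

Conversely, elements of `VN(G)` commute with right translations. Pairing `A M_a B` with `θ(f)(h)`
therefore brings out the sums `∑ r, f(r) a(xr)`, which are pairings of `a` with `δ_x * f`. They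
vanish because `J` is a left ideal (`tracePairing_bimodule_theta`). Linearity and weak-* closure
give the rest. -/

open scoped ENNReal Topology

noncomputable section

namespace VNBimodule

universe u

/-! ### Completely bounded multipliers of `A(G)` as Schur multipliers -/

section Schur

variable {G : Type u}

/-- The embedding of `ℂⁿ` into `ℓ²(G)` along an injection `e : Fin n → G`. -/
def finEmbed {n : ℕ} (e : Fin n ↪ G) : EuclideanSpace ℂ (Fin n) →ₗᵢ[ℂ] Ell2 G := by
  classical
  exact
  { toFun v := ∑ i, v i • lp.single 2 (e i) (1 : ℂ)
    map_add' v w := by simp [add_smul, Finset.sum_add_distrib]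
    map_smul' c v := by simp [Finset.smul_sum, mul_smul]
    norm_map' v := by
      have hon : Orthonormal ℂ fun i => (lp.single 2 (e i) (1 : ℂ) : Ell2 G) := by
        rw [orthonormal_iff_ite]
        intro i j
        rw [lp.inner_single_left]
        rcases eq_or_ne i j with rfl | h
        · simp
        · simp [h]
      have h := hon.inner_sum v v Finset.univ
      have h2 := congrArg Complex.re h
      rw [← sq_eq_sq₀ (norm_nonneg _) (norm_nonneg _), EuclideanSpace.norm_sq_eq,
        ← inner_self_eq_norm_sq (𝕜 := ℂ)]
      refine h2.trans ?_
      simp only [← Complex.normSq_eq_conj_mul_self, Complex.normSq_eq_norm_sq, Complex.re_sum,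
        Complex.ofReal_re] }

theorem finEmbed_apply [DecidableEq G] {n : ℕ} (e : Fin n ↪ G) (v : EuclideanSpace ℂ (Fin n)) :
    finEmbed e v = ∑ i, v i • lp.single 2 (e i) (1 : ℂ) := by
  obtain rfl : ‹DecidableEq G› = Classical.decEq G := Subsingleton.elim _ _
  rfl

open scoped Matrix.Norms.L2Operator

/-- The matrix of the compression of `T` to the span of the basis vectors indexed by `e`. -/
def compress {n : ℕ} (e : Fin n ↪ G) (T : BEll2 G) : Matrix (Fin n) (Fin n) ℂ :=
  (Matrix.toEuclideanCLM (n := Fin n) (𝕜 := ℂ)).symm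
    ((finEmbed e).toContinuousLinearMap.adjoint ∘L T ∘L (finEmbed e).toContinuousLinearMap)

theorem toEuclideanCLM_compress {n : ℕ} (e : Fin n ↪ G) (T : BEll2 G) :
    Matrix.toEuclideanCLM (n := Fin n) (𝕜 := ℂ) (compress e T) =
      (finEmbed e).toContinuousLinearMap.adjoint ∘L T ∘L (finEmbed e).toContinuousLinearMap := by
  simp [compress]

theorem norm_compress_le {n : ℕ} (e : Fin n ↪ G) (T : BEll2 G) : ‖compress e T‖ ≤ ‖T‖ := by
  rw [← Matrix.l2_opNorm_toEuclideanCLM, toEuclideanCLM_compress]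
  have h1 : ‖(finEmbed e).toContinuousLinearMap‖ ≤ 1 := (finEmbed e).norm_toContinuousLinearMap_le
  calc _ ≤ ‖(finEmbed e).toContinuousLinearMap.adjoint‖ *
        (‖T‖ * ‖(finEmbed e).toContinuousLinearMap‖) :=
        (ContinuousLinearMap.opNorm_comp_le _ _).trans
          (mul_le_mul_of_nonneg_left (ContinuousLinearMap.opNorm_comp_le _ _) (norm_nonneg _))
    _ ≤ 1 * (‖T‖ * 1) := by
        rw [LinearIsometryEquiv.norm_map]
        gcongr
    _ = ‖T‖ := by ring

theorem compress_apply [DecidableEq G] {n : ℕ} (e : Fin n ↪ G) (T : BEll2 G) (i j : Fin n) :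
    compress e T i j = T (lp.single 2 (e j) 1) (e i) := by
  have h := congrArg
    (fun S => inner ℂ (EuclideanSpace.single i (1 : ℂ)) (S (EuclideanSpace.single j (1 : ℂ))))
    (toEuclideanCLM_compress e T)
  simp only [ContinuousLinearMap.comp_apply, ContinuousLinearMap.adjoint_inner_right] at h
  have hs : ∀ k, finEmbed e (EuclideanSpace.single k (1 : ℂ)) = lp.single 2 (e k) (1 : ℂ) := by
    intro k
    rw [finEmbed_apply, Finset.sum_eq_single k]
    · simp
    · intro b _ hb
      simp [hb]
    · simp
  simp only [LinearIsometry.coe_toContinuousLinearMap, hs, lp.inner_single_left,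
    EuclideanSpace.inner_single_left, Matrix.ofLp_toEuclideanCLM] at h
  simpa using h

/-- The bound uses the norm of the compression, not `‖T‖`, so that an operator norm can be recovered
from the finite compressions alone. -/
theorem inner_finEmbed_le {n : ℕ} (e : Fin n ↪ G) (T : BEll2 G)
    (v w : EuclideanSpace ℂ (Fin n)) :
    ‖inner ℂ (finEmbed e w) (T (finEmbed e v))‖ ≤
      ‖compress e T‖ * ‖finEmbed e w‖ * ‖finEmbed e v‖ := by
  have h : inner ℂ (finEmbed e w) (T (finEmbed e v)) =
      inner ℂ w (Matrix.toEuclideanCLM (n := Fin n) (𝕜 := ℂ) (compress e T) v) := by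
    rw [toEuclideanCLM_compress]
    simp [ContinuousLinearMap.adjoint_inner_right]
  rw [h, LinearIsometry.norm_map, LinearIsometry.norm_map]
  refine (norm_inner_le_norm _ _).trans ?_
  have h2 := (Matrix.toEuclideanCLM (n := Fin n) (𝕜 := ℂ) (compress e T)).le_opNorm v
  rw [Matrix.l2_opNorm_toEuclideanCLM] at h2
  nlinarith [norm_nonneg w]

theorem trunc_mem_range_finEmbed [DecidableEq G] (a : Ell2 G) (F : Finset G) :
    ∃ v, finEmbed (F.equivFin.symm.toEmbedding.trans (Function.Embedding.subtype _)) v =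
      ∑ x ∈ F, lp.single 2 x (a x) := by
  refine ⟨WithLp.toLp 2 fun i => a (F.equivFin.symm i), ?_⟩
  rw [finEmbed_apply, ← Finset.sum_coe_sort F, ← F.equivFin.symm.sum_comp]
  refine Finset.sum_congr rfl fun i _ => ?_
  simp [← lp.single_smul]

theorem inner_reindex_left (e : Equiv.Perm G) (f g : Ell2 G) :
    inner ℂ (reindex e f) g = inner ℂ f (reindex e.symm g) := by
  rw [lp.inner_eq_tsum, lp.inner_eq_tsum, ← e.symm.tsum_eq]
  simp

theorem tendsto_trunc [DecidableEq G] (a : Ell2 G) :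
    Filter.Tendsto (fun F : Finset G => ∑ x ∈ F, (lp.single 2 x (a x) : Ell2 G))
        Filter.atTop (𝓝 a) := lp.hasSum_single (by simp) a

variable [Group G]

theorem leftReg_mul (s t : G) : leftReg (s * t) = leftReg s * leftReg t := by
  ext f x
  simp [mul_assoc]

theorem star_leftReg (s : G) : star (leftReg s) = leftReg s⁻¹ := by
  rw [ContinuousLinearMap.star_eq_adjoint, eq_comm, ContinuousLinearMap.eq_adjoint_iff]
  intro f g
  refine (inner_reindex_left _ _ _).trans ?_
  congr 1
  ext t
  simp

theorem leftReg_ne_zero (s : G) : leftReg s ≠ 0 := by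
  classical
  intro h
  have := congrArg (fun T : BEll2 G => T (lp.single 2 1 1) s) h
  simp at this

/-- The *-homomorphism `t ↦ [t_{ij} λ_{e(i) e(j)⁻¹}]`. -/
def translationHom {n : ℕ} (e : Fin n → G) :
    Matrix (Fin n) (Fin n) ℂ →⋆ₙₐ[ℂ] CStarMatrix (Fin n) (Fin n) (BEll2 G) where
  toFun M := CStarMatrix.ofMatrix (Matrix.of fun i j => M i j • leftReg (e i * (e j)⁻¹))
  map_smul' c M := by ext1 i j; simp [mul_smul]
  map_zero' := by ext1 i j; simp
  map_add' M N := by ext1 i j; simp [add_smul]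
  map_mul' M N := by
    ext1 i j
    simp only [CStarMatrix.ofMatrix_apply, Matrix.of_apply, CStarMatrix.mul_apply, Matrix.mul_apply,
      Finset.sum_smul, smul_mul_smul_comm, ← leftReg_mul]
    simp
  map_star' M := by
    ext1 i j
    simp [CStarMatrix.star_apply, star_leftReg, Matrix.star_apply]

/-- An injective *-homomorphism between C*-algebras is isometric; injectivity holds because no `λ_s`
vanishes. -/
theorem norm_translationHom {n : ℕ} (e : Fin n → G) (M : Matrix (Fin n) (Fin n) ℂ) :
    ‖translationHom e M‖ = ‖M‖ := by
  refine NonUnitalStarAlgHom.norm_map (translationHom e) ?_ M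
  intro M N h
  ext i j
  have := congrFun (congrFun h i) j
  exact smul_left_injective ℂ (leftReg_ne_zero _) this

theorem leftReg_mem_vN (s : G) : leftReg s ∈ vN G := by
  rw [vN, ← SetLike.mem_coe, coe_weakStarClosure]
  exact @subset_closure _ (weakStarTopology G) _ _ (Submodule.subset_span ⟨s, rfl⟩)

/-- Pairing `λ_s` with an element of `A(G)` is evaluation at `s`, so the dual of multiplication by
`u` has `λ_s` as an eigenvector. -/
theorem IsMultiplierDual.apply_leftReg {u : G → ℂ} (hu : IsMultiplier u)
    {Φ : vN G →ₗ[ℂ] vN G} (hΦ : IsMultiplierDual u Φ) (s : G) :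
    Φ ⟨leftReg s, leftReg_mem_vN s⟩ = u s • ⟨leftReg s, leftReg_mem_vN s⟩ := by
  ext1
  refine ContinuousLinearMap.ext fun ξ => ext_inner_left ℂ fun η => ?_
  obtain ⟨ξ', η', h⟩ := hu _ ⟨ξ, η, rfl⟩
  have h1 := congrFun h s
  simp only [coeff, Pi.mul_apply] at h1
  rw [hΦ _ ξ η ξ' η' h.symm]
  simp [inner_smul_right, h1]

/-- A completely bounded multiplier of `A(G)` defines a bounded Schur multiplier. -/
theorem McbNormLE.norm_schur_le {u : G → ℂ} {L : ℝ} (hu : McbNormLE u L) {n : ℕ}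
    (e : Fin n → G) (M : Matrix (Fin n) (Fin n) ℂ) :
    ‖(Matrix.of fun i j => u (e i * (e j)⁻¹) * M i j : Matrix (Fin n) (Fin n) ℂ)‖ ≤ L * ‖M‖ := by
  obtain ⟨hm, Φ, hΦ, hcb⟩ := hu
  -- The test matrix is `translationHom e M`, read over `VN(G)`: applying `Φ` entrywise multiplies
  -- its `(i, j)` entry by `u(e(i) e(j)⁻¹)`.
  have h := hcb n (Matrix.of fun i j => M i j • ⟨_, leftReg_mem_vN (e i * (e j)⁻¹)⟩)
  rw [← norm_translationHom e, ← norm_translationHom e M]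
  refine (le_of_eq ?_).trans (h.trans (le_of_eq ?_))
  · congr 1
    ext1 i j
    change (u (e i * (e j)⁻¹) * M i j) • leftReg (e i * (e j)⁻¹) =
      ((Φ (M i j • ⟨leftReg (e i * (e j)⁻¹), leftReg_mem_vN _⟩) : vN G) : BEll2 G)
    rw [map_smul, hΦ.apply_leftReg hm, smul_smul, mul_comm]
    rfl
  · congr 2

/-- The Schur multiplier of a completely bounded multiplier `u` has norm at most `‖u‖_mcb`. -/
theorem McbNormLE.norm_le {u : G → ℂ} {L : ℝ} (hL : 0 ≤ L) (hu : McbNormLE u L)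
    [DecidableEq G] {S T : BEll2 G}
    (h : ∀ x y, S (lp.single 2 x 1) y = u (y * x⁻¹) * T (lp.single 2 x 1) y) :
    ‖S‖ ≤ L * ‖T‖ := by
  have key : ∀ a b : Ell2 G, ‖inner ℂ b (S a)‖ ≤ L * ‖T‖ * ‖b‖ * ‖a‖ := by
    intro a b
    refine le_of_tendsto_of_tendsto'
      (((tendsto_trunc b).inner ((S.continuous.tendsto _).comp (tendsto_trunc a))).norm)
      (((tendsto_trunc b).norm.const_mul (L * ‖T‖)).mul (tendsto_trunc a).norm) ?_
    intro F
    obtain ⟨v, hv⟩ := trunc_mem_range_finEmbed a F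
    obtain ⟨w, hw⟩ := trunc_mem_range_finEmbed b F
    simp only [Function.comp_apply, ← hv, ← hw]
    refine (inner_finEmbed_le _ S v w).trans ?_
    gcongr
    generalize F.equivFin.symm.toEmbedding.trans (Function.Embedding.subtype _) = e
    -- The compression of `S` is the Schur multiple of that of `T`, so the finite matrix estimate
    -- applies, uniformly in `F`.
    refine le_trans (le_of_eq ?_) ((hu.norm_schur_le e (compress e T)).trans
      (mul_le_mul_of_nonneg_left (norm_compress_le e T) hL))
    congr 1
    ext i j
    simp [compress_apply, h]
  refine ContinuousLinearMap.opNorm_le_bound _ (by positivity) fun a => ?_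
  -- Testing against `b = S a` gives a bound on `‖S a‖ ^ 2`; one factor is cancelled, hence the
  -- separate case `‖S a‖ = 0`.
  rcases (norm_nonneg (S a)).eq_or_lt with h0 | h0
  · rw [← h0]; positivity
  · have := key a (S a)
    rw [inner_self_eq_norm_sq_to_K] at this
    simp only [norm_pow, RCLike.norm_ofReal, abs_norm] at this
    nlinarith

end Schur

/-! ### The trace pairing and weak-* convergence of bounded nets -/

section Pairing

variable {G : Type u}

theorem isRep_mul (f g : Ell2 G) :
    IsRep (fun x y => f x * g y) (fun _ : Unit => f) (fun _ : Unit => g) :=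
  ⟨(hasSum_fintype _).summable, (hasSum_fintype _).summable, fun x y => by
    simp⟩

/-- The elementary tensor `f ⊗ g` in `T(G)`. -/
def tensor (f g : Ell2 G) : traceClass G := ⟨fun x y => f x * g y, (isRep_mul f g).exists_nat⟩

theorem tracePairing_tensor (T : BEll2 G) (f g : Ell2 G) :
    tracePairing T (tensor f g) = inner ℂ (star g) (T f) := by
  refine (hasSum_tracePairing T (tensor f g) (isRep_mul f g)).unique ?_
  simp

theorem tracePairing_add_right (T : BEll2 G) (h k : traceClass G) :
    tracePairing T (h + k) = tracePairing T h + tracePairing T k := by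
  obtain ⟨f, g, H⟩ := h.2
  obtain ⟨f', g', H'⟩ := k.2
  have hr : IsRep ((h + k : traceClass G) : G → G → ℂ) (Sum.elim f f') (Sum.elim g g') := by
    refine ⟨?_, ?_, fun x y => ?_⟩
    · exact (H.summable_left.hasSum.sum (f := fun i => ‖Sum.elim f f' i‖ ^ 2)
        H'.summable_left.hasSum).summable
    · exact (H.summable_right.hasSum.sum (f := fun i => ‖Sum.elim g g' i‖ ^ 2)
        H'.summable_right.hasSum).summable
    · exact (H.hasSum x y).sum (f := fun i => Sum.elim f f' i x * Sum.elim g g' i y)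
        (H'.hasSum x y)
  exact (hasSum_tracePairing T _ hr).unique ((hasSum_tracePairing T h H).sum
    (f := fun i => inner ℂ (star (Sum.elim g g' i)) (T (Sum.elim f f' i)))
    (hasSum_tracePairing T k H'))

theorem tracePairing_smul_right (T : BEll2 G) (c : ℂ) (h : traceClass G) :
    tracePairing T (c • h) = c * tracePairing T h := by
  obtain ⟨f, g, H⟩ := h.2
  have hr : IsRep ((c • h : traceClass G) : G → G → ℂ) (fun i => c • f i) g := by
    refine ⟨?_, H.summable_right, fun x y => ?_⟩
    · simpa [norm_smul, mul_pow] using H.summable_left.mul_left (‖c‖ ^ 2)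
    · simpa [mul_assoc] using (H.hasSum x y).mul_left c
  refine (hasSum_tracePairing T _ hr).unique ?_
  simpa [inner_smul_right] using (hasSum_tracePairing T h H).mul_left c

/-- The functional `⟨T, ·⟩_t` on `T(G)`. -/
def traceFunctional (T : BEll2 G) : traceClass G →ₗ[ℂ] ℂ where
  toFun := tracePairing T
  map_add' := tracePairing_add_right T
  map_smul' c h := tracePairing_smul_right T c h

theorem norm_tracePairing_le_of_traceNorm_lt (T : BEll2 G) {h : traceClass G} {ε : ℝ}
    (hε : traceNorm h < ε) : ‖tracePairing T h‖ ≤ ‖T‖ * ε := by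
  obtain ⟨f₀, g₀, H₀⟩ := h.2
  rw [traceNorm] at hε
  obtain ⟨c, ⟨f, g, H, rfl⟩, hc⟩ := exists_lt_of_csInf_lt (by exact ⟨_, f₀, g₀, H₀, rfl⟩) hε
  refine (((hasSum_tracePairing T h H).norm_le_of_bounded (H.summable_mul.mul_left ‖T‖).hasSum
    fun i => norm_star_inner_le _ _ _)).trans ?_
  rw [tsum_mul_left]
  gcongr

theorem traceNorm_zero : traceNorm (0 : traceClass G) = 0 := by
  have hb : ∀ c ∈ {c | ∃ f g : ℕ → Ell2 G, IsRep ((0 : traceClass G) : G → G → ℂ) f g ∧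
      c = ∑' i, ‖f i‖ * ‖g i‖}, 0 ≤ c := by
    rintro c ⟨f, g, -, rfl⟩
    exact tsum_nonneg fun i => by positivity
  refine le_antisymm (csInf_le ⟨0, hb⟩ ⟨0, 0, ⟨by simp, by simp, fun x y => by simp⟩, by simp⟩)
    (Real.sInf_nonneg hb)

theorem continuous_tracePairing (h : traceClass G) :
    @Continuous _ _ (weakStarTopology G) _ fun T => tracePairing T h :=
  letI := weakStarTopology G
  (continuous_apply h).comp (continuous_induced_dom
    (f := fun (T : BEll2 G) (h : traceClass G) => tracePairing T h))

/-- For truncated vectors the inner product is a finite combination of matrix entries. The uniform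
bound `C` makes the truncation error small uniformly in `i`, so the two limits may be interchanged.
-/
theorem tendsto_inner_of_bounded [DecidableEq G] {ι : Type*} {l : Filter ι} {S : ι → BEll2 G}
    {T : BEll2 G} {C : ℝ} (hC : ∀ i, ‖S i‖ ≤ C)
    (h : ∀ x y, Filter.Tendsto (fun i => S i (lp.single 2 x 1) y) l
      (𝓝 (T (lp.single 2 x 1) y))) (a b : Ell2 G) :
    Filter.Tendsto (fun i => inner ℂ (star b) (S i a)) l (𝓝 (inner ℂ (star b) (T a))) := by
  let tr : Ell2 G → Finset G → Ell2 G := fun a F => ∑ x ∈ F, lp.single 2 x (a x)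
  have ha : Filter.Tendsto (tr a) Filter.atTop (𝓝 a) := tendsto_trunc a
  have hb : Filter.Tendsto (tr b) Filter.atTop (𝓝 b) := tendsto_trunc b
  refine TendstoUniformly.tendsto_of_eventually_tendsto (p := (Filter.atTop : Filter (Finset G)))
    (F := fun F i => inner ℂ (star (tr b F)) (S i (tr a F)))
    (L := fun F => inner ℂ (star (tr b F)) (T (tr a F))) ?_ (Filter.Eventually.of_forall ?_)
    (((continuous_star.tendsto _).comp hb).inner ((T.continuous.tendsto _).comp ha))
  · rw [Metric.tendstoUniformly_iff]
    intro ε hε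
    have hlim : Filter.Tendsto (fun F => C * (‖a - tr a F‖ * ‖b‖) + C * (‖a‖ * ‖b - tr b F‖))
        Filter.atTop (𝓝 0) := by
      have h1 : Filter.Tendsto (fun F => ‖a - tr a F‖) Filter.atTop (𝓝 0) := by
        simpa using (ha.const_sub a).norm
      have h2 : Filter.Tendsto (fun F => ‖b - tr b F‖) Filter.atTop (𝓝 0) := by
        simpa using (hb.const_sub b).norm
      simpa using ((h1.mul_const ‖b‖).const_mul C).add ((h2.const_mul ‖a‖).const_mul C)
    filter_upwards [hlim.eventually_lt_const hε] with F hF i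
    refine lt_of_le_of_lt ?_ hF
    have hsplit : inner ℂ (star b) (S i a) - inner ℂ (star (tr b F)) (S i (tr a F)) =
        inner ℂ (star b) (S i (a - tr a F)) + inner ℂ (star (b - tr b F)) (S i (tr a F)) := by
      simp only [map_sub, star_sub, inner_sub_left, inner_sub_right]
      ring
    rw [dist_eq_norm, hsplit]
    have hC0 : 0 ≤ C := (norm_nonneg _).trans (hC i)
    refine (norm_add_le _ _).trans (add_le_add ?_ ?_)
    · exact (norm_star_inner_le _ _ _).trans (by gcongr; exact hC i)
    · refine (norm_star_inner_le _ _ _).trans ?_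
      gcongr
      · exact hC i
      · exact norm_trunc_le a F
  · intro F
    simp only [tr, inner_trunc]
    exact tendsto_finsetSum _ fun x _ => tendsto_finsetSum _ fun y _ => (h x y).const_mul _

/-- Dominated convergence for the series over a representation of `k`; the dominating function is
independent of `i`, so an arbitrary filter is allowed. -/
theorem tendsto_tracePairing_of_bounded [DecidableEq G] {ι : Type*} {l : Filter ι}
    {S : ι → BEll2 G} {T : BEll2 G} {C : ℝ} (hC : ∀ i, ‖S i‖ ≤ C)
    (h : ∀ x y, Filter.Tendsto (fun i => S i (lp.single 2 x 1) y) l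
      (𝓝 (T (lp.single 2 x 1) y))) (k : traceClass G) :
    Filter.Tendsto (fun i => tracePairing (S i) k) l (𝓝 (tracePairing T k)) := by
  obtain ⟨f, g, H⟩ := k.2
  simp only [← (hasSum_tracePairing _ k H).tsum_eq]
  refine tendsto_tsum_of_dominated_convergence (bound := fun j => C * (‖f j‖ * ‖g j‖))
    (H.summable_mul.mul_left _) (fun j => tendsto_inner_of_bounded hC h _ _)
    (Filter.Eventually.of_forall fun i j => (norm_star_inner_le _ _ _).trans ?_)
  gcongr
  exact hC i

/-- The `g`-th diagonal `x ↦ T(x, gx)` of the matrix of `T`. -/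
def diagonal [DecidableEq G] [Mul G] (T : BEll2 G) (g : G) : EllInf G :=
  ⟨fun x => T (lp.single 2 x 1) (g * x), memℓp_infty ⟨‖T‖, by
    rintro _ ⟨x, rfl⟩
    refine (lp.norm_apply_le_norm (by simp) _ _).trans ((T.le_opNorm _).trans ?_)
    simp⟩⟩

theorem diagonal_apply [DecidableEq G] [Mul G] (T : BEll2 G) (g x : G) :
    diagonal T g x = T (lp.single 2 x 1) (g * x) := rfl

theorem summable_norm (f : Ell1 G) : Summable fun r => ‖f r‖ := by
  simpa using (lp.memℓp f).summable (by norm_num)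

theorem star_reindex (e : Equiv.Perm G) (f : Ell2 G) :
    star (reindex e f) = reindex e (star f) := rfl

end Pairing

/-! ### `Ran J`, its annihilator, and the bimodule generated by `J^⊥` -/

section Group

variable {G : Type u} [Group G]

/-- Each weight `f(r)` is split as `c(r)²` between the two factors; since `‖c(r)‖² = ‖f(r)‖`, both
families are square summable. -/
theorem isRep_theta {ι : Type*} (f : Ell1 G) (h : traceClass G) {a b : ι → Ell2 G}
    (H : IsRep (h : G → G → ℂ) a b) {c : G → ℂ} (hc : ∀ r, c r ^ 2 = f r) :
    IsRep (theta f h : G → G → ℂ)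
      (fun p : G × ι => c p.1 • reindex (Equiv.mulRight p.1⁻¹) (a p.2))
      (fun p : G × ι => c p.1 • reindex (Equiv.mulRight p.1⁻¹) (b p.2)) := by
  have hn : ∀ r, ‖c r‖ ^ 2 = ‖f r‖ := fun r => by rw [← norm_pow, hc]
  have hf := summable_norm f
  have hsq : ∀ k : ι → Ell2 G, (Summable fun i => ‖k i‖ ^ 2) →
      Summable fun p : G × ι => ‖c p.1 • reindex (Equiv.mulRight p.1⁻¹) (k p.2)‖ ^ 2 := by
    intro k hk
    simp only [norm_smul, mul_pow, hn, LinearIsometry.norm_map]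
    exact Summable.mul_of_nonneg (f := fun r => ‖f r‖) (g := fun i => ‖k i‖ ^ 2) hf hk
      (fun _ => norm_nonneg _) (fun _ => by positivity)
  refine ⟨hsq a H.summable_left, hsq b H.summable_right, fun s t => ?_⟩
  have hab : ∀ (k : Ell2 G) (x : G), ‖k x‖ ≤ ‖k‖ := fun k x =>
    lp.norm_apply_le_norm (by norm_num) k x
  have hsum : Summable fun p : G × ι => f p.1 * (a p.2 (s * p.1⁻¹) * b p.2 (t * p.1⁻¹)) := by
    refine Summable.of_norm_bounded
      (Summable.mul_of_nonneg (f := fun r => ‖f r‖) (g := fun i => ‖a i‖ * ‖b i‖)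
        hf H.summable_mul (fun _ => norm_nonneg _) (fun _ => by positivity)) ?_
    rintro ⟨r, i⟩
    simp only [norm_mul]
    gcongr
    · exact hab _ _
    · exact hab _ _
  have h2 := hsum.hasSum.prod_fiberwise fun r => (H.hasSum (s * r⁻¹) (t * r⁻¹)).mul_left (f r)
  change HasSum _ (∑' r, f r * (h : G → G → ℂ) (s * r⁻¹) (t * r⁻¹))
  rw [h2.tsum_eq]
  convert hsum.hasSum using 2 with p
  simp only [lp.coeFn_smul, Pi.smul_apply, reindex_apply, Equiv.coe_mulRight, smul_eq_mul]
  rw [← hc]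
  ring

theorem hasSum_tracePairing_theta {ι : Type*} (T : BEll2 G) (f : Ell1 G) (h : traceClass G)
    {a b : ι → Ell2 G} (H : IsRep (h : G → G → ℂ) a b) :
    HasSum (fun p : G × ι => f p.1 * inner ℂ (reindex (Equiv.mulRight p.1⁻¹) (star (b p.2)))
      (T (reindex (Equiv.mulRight p.1⁻¹) (a p.2)))) (tracePairing T (theta f h)) := by
  have hc : ∀ r, ∃ c : ℂ, c ^ 2 = f r := fun r => IsAlgClosed.exists_pow_nat_eq _ (by norm_num)
  choose c hc using hc
  convert hasSum_tracePairing T _ (isRep_theta f h H hc) using 2 with p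
  -- The `star` and the conjugate-linear slot cancel, so the two scalars multiply to `c² = f`,
  -- without an absolute value.
  rw [star_smul, star_reindex, map_smul, inner_smul_left, inner_smul_right, ← hc]
  simp
  ring

theorem theta_mem_ran {J : Submodule ℂ (Ell1 G)} {f : Ell1 G} (hf : f ∈ J) (h : traceClass G) :
    theta f h ∈ ran J := fun ε hε =>
  ⟨theta f h, Submodule.subset_span ⟨f, hf, h, rfl⟩, by rwa [sub_self, traceNorm_zero]⟩

theorem tracePairing_eq_zero_of_mem_ran {J : Submodule ℂ (Ell1 G)} {T : BEll2 G}
    (hT : ∀ f ∈ J, ∀ h, tracePairing T (theta f h) = 0) {k : traceClass G} (hk : k ∈ ran J) :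
    tracePairing T k = 0 := by
  have hspan : Submodule.span ℂ {k' | ∃ f ∈ J, ∃ h, k' = theta f h} ≤
      LinearMap.ker (traceFunctional T) := by
    rw [Submodule.span_le]
    rintro _ ⟨f, hf, h, rfl⟩
    exact hT f hf h
  rw [← norm_eq_zero]
  refine le_antisymm (le_of_forall_pos_le_add fun ε hε => ?_) (norm_nonneg _)
  -- The `+ 1` keeps the denominator positive when `T = 0`.
  obtain ⟨k', hk', hlt⟩ := hk (ε / (‖T‖ + 1)) (by positivity)
  have h0 : traceFunctional T k' = 0 := hspan hk'
  have h1 : tracePairing T k = tracePairing T (k - k') := by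
    change traceFunctional T k = traceFunctional T (k - k')
    rw [map_sub, h0, sub_zero]
  rw [h1, zero_add]
  refine (norm_tracePairing_le_of_traceNorm_lt T hlt).trans ?_
  rw [mul_div_assoc', div_le_iff₀ (by positivity)]
  nlinarith

/-- Right translation by `r` turns `δ_1 ⊗ δ_g` into `δ_r ⊗ δ_{gr}`, which picks out the entry
`T_g(r)`. Pairing `T` with `θ(f)(δ_1 ⊗ δ_g)` thus gives `∑ r, f(r) T_g(r)`. -/
theorem diagonal_mem_annihilator [DecidableEq G] {J : Submodule ℂ (Ell1 G)} {T : BEll2 G}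
    (hT : T ∈ traceAnnihilator (ran J)) (g : G) : diagonal T g ∈ annihilator J := by
  intro f hf
  have h := hasSum_tracePairing_theta T f (tensor (lp.single 2 1 1) (lp.single 2 g 1))
    (isRep_mul (lp.single 2 1 1) (lp.single 2 g 1))
  rw [hT _ (theta_mem_ran hf _)] at h
  have h' := (Equiv.prodPUnit G).symm.hasSum_iff.2 h
  rw [← h'.tsum_eq]
  refine tsum_congr fun r => ?_
  have hs : ∀ x : G, reindex (Equiv.mulRight r⁻¹) (lp.single 2 x (1 : ℂ)) =
      lp.single 2 (x * r) (1 : ℂ) := by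
    intro x
    ext t
    simp [lp.single_apply, Pi.single_apply, mul_inv_eq_iff_eq_mul]
  have hstar : star (lp.single 2 g (1 : ℂ) : Ell2 G) = lp.single 2 g (1 : ℂ) := by
    ext t
    rcases eq_or_ne t g with rfl | ht
    · simp
    · simp [ht]
  simp [hstar, hs, lp.inner_single_left, diagonal_apply, mul_comm]

/-- The sum is the pairing of `a` with `δ_x * f`, and this is where the left ideal property enters.
-/
theorem tsum_mul_translate_eq_zero {J : Submodule ℂ (Ell1 G)} (hJ : IsClosedLeftIdeal J)
    {f : Ell1 G} (hf : f ∈ J) {a : EllInf G} (ha : a ∈ annihilator J) (x : G) :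
    ∑' r, f r * a (x * r) = 0 := by
  classical
  rw [← ha _ (hJ.conv_mem (lp.single 1 x 1) f hf), ← (Equiv.mulLeft x).tsum_eq fun y =>
    a y * conv (lp.single 1 x 1) f y]
  refine tsum_congr fun r => ?_
  have : conv (lp.single 1 x 1) f (x * r) = f r := by
    change ∑' z, (lp.single 1 x (1 : ℂ) : Ell1 G) z * f (z⁻¹ * (x * r)) = f r
    rw [tsum_eq_single x fun z hz => by simp [hz]]
    simp
  simp [this, mul_comm]

/-- Left and right translations commute. Tested on vectors, commutation becomes an equality of two
trace pairings, a linear weak-* closed condition on `A`, so it passes from the `λ_s` to their closed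
span. -/
theorem vN_commute {A : BEll2 G} (hA : A ∈ vN G) (r : G) (ξ : Ell2 G) :
    A (reindex (Equiv.mulRight r) ξ) = reindex (Equiv.mulRight r) (A ξ) := by
  refine ext_inner_left ℂ fun η => ?_
  have key : ∀ A ∈ vN G, tracePairing A (tensor (reindex (Equiv.mulRight r) ξ) (star η)) =
      tracePairing A (tensor ξ (reindex (Equiv.mulRight r).symm (star η))) := by
    intro A hA
    rw [vN, ← SetLike.mem_coe, coe_weakStarClosure] at hA
    let _ := weakStarTopology G
    refine closure_minimal
      (t := {A | tracePairing A (tensor (reindex (Equiv.mulRight r) ξ) (star η)) =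
        tracePairing A (tensor ξ (reindex (Equiv.mulRight r).symm (star η)))}) ?_
      (isClosed_eq (continuous_tracePairing _) (continuous_tracePairing _)) hA
    intro B hB
    induction hB using Submodule.span_induction with
    | mem B hB =>
      obtain ⟨s, rfl⟩ := hB
      simp only [Set.mem_ofPred_eq, tracePairing_tensor, star_reindex, star_star,
        inner_reindex_left, Equiv.symm_symm]
      congr 1
      ext t
      simp [mul_assoc]
    | zero => simp [tracePairing_tensor]
    | add B C _ _ hB hC =>
      simp only [Set.mem_ofPred_eq, tracePairing_add] at *
      rw [hB, hC]
    | smul c B _ hB =>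
      simp only [Set.mem_ofPred_eq, tracePairing_smul] at *
      rw [hB]
  have := key A hA
  simpa [tracePairing_tensor, star_reindex, inner_reindex_left] using this

/-- Absolute convergence allows summing over `r` first, which meets `hz`. -/
theorem tsum_mul_inner_eq_zero {f : Ell1 G} {a : EllInf G}
    (hz : ∀ x, ∑' r, f r * a (x * r) = 0) (w v : Ell2 G) :
    ∑' r, f r * ∑' x, (a (x * r) * v x) * starRingEnd ℂ (w x) = 0 := by
  have hwv : Summable fun x => ‖v x‖ * ‖w x‖ := by
    simpa using (lp.summable_inner (𝕜 := ℂ) w v).norm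
  have hs : Summable (Function.uncurry fun r x =>
      f r * ((a (x * r) * v x) * starRingEnd ℂ (w x))) := by
    refine Summable.of_norm_bounded
      (((summable_norm f).mul_of_nonneg hwv (fun _ => norm_nonneg _)
        (fun _ => by positivity)).mul_left ‖a‖) ?_
    rintro ⟨r, x⟩
    simp only [Function.uncurry, norm_mul, RCLike.norm_conj]
    have := lp.norm_apply_le_norm (by simp) a (x * r)
    calc ‖f r‖ * (‖a (x * r)‖ * ‖v x‖ * ‖w x‖) ≤ ‖f r‖ * (‖a‖ * ‖v x‖ * ‖w x‖) := by gcongr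
      _ = _ := by ring
  simp only [← tsum_mul_left]
  refine hs.tsum_comm.symm.trans ((tsum_congr fun x => ?_).trans tsum_zero)
  calc ∑' r, f r * (a (x * r) * v x * starRingEnd ℂ (w x))
      = ∑' r, f r * a (x * r) * (v x * starRingEnd ℂ (w x)) := tsum_congr fun r => by ring
    _ = 0 := by rw [tsum_mul_right, hz, zero_mul]

/-- The right translations pass through `A` and `B` and conjugate `M_a` into multiplication by `x ↦
a(xr)`. What remains, for each term of a representation of `h`, is the double sum of
`tsum_mul_inner_eq_zero`. -/
theorem tracePairing_bimodule_theta {J : Submodule ℂ (Ell1 G)} (hJ : IsClosedLeftIdeal J)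
    {A B : BEll2 G} (hA : A ∈ vN G) (hB : B ∈ vN G) {a : EllInf G} (ha : a ∈ annihilator J)
    {f : Ell1 G} (hf : f ∈ J) (h : traceClass G) :
    tracePairing (A * mulOp a * B) (theta f h) = 0 := by
  obtain ⟨k, g, H⟩ := h.2
  have hs := (hasSum_tracePairing_theta (A * mulOp a * B) f h H)
  have hs' := (Equiv.prodComm ℕ G).hasSum_iff.2 hs
  rw [← hs'.tsum_eq, hs'.summable.tsum_prod]
  refine (tsum_congr fun i => ?_).trans tsum_zero
  rw [← tsum_mul_inner_eq_zero (tsum_mul_translate_eq_zero hJ hf ha)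
    (A.adjoint (star (g i))) (B (k i))]
  refine tsum_congr fun r => ?_
  have hr : (Equiv.mulRight r⁻¹).symm = Equiv.mulRight r := by
    ext t
    simp
  simp only [Function.comp_apply, Equiv.prodComm_apply, Prod.swap, mul_apply_eq_comp]
  rw [inner_reindex_left, hr, ← vN_commute hA, vN_commute hB,
    ← ContinuousLinearMap.adjoint_inner_left, lp.inner_eq_tsum]
  simp

theorem leftReg_mul_mulOp_mem {U : Set (EllInf G)} {a : EllInf G} (ha : a ∈ U) (g : G) :
    leftReg g * mulOp a ∈ Submodule.span ℂ
      {T | ∃ A ∈ vN G, ∃ a ∈ U, ∃ B ∈ vN G, T = A * mulOp a * B} := by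
  refine Submodule.subset_span ⟨leftReg g, leftReg_mem_vN g, a, ha, leftReg 1,
    leftReg_mem_vN 1, ?_⟩
  ext f t
  simp

theorem bim_annihilator_subset {J : Submodule ℂ (Ell1 G)} (hJ : IsClosedLeftIdeal J) :
    (bim (annihilator J) : Set (BEll2 G)) ⊆ traceAnnihilator (ran J) := by
  intro T hT k hk
  rw [bim, coe_weakStarClosure] at hT
  let _ := weakStarTopology G
  refine closure_minimal (t := {T | tracePairing T k = 0}) ?_
    (isClosed_eq (continuous_tracePairing _) continuous_const) hT
  intro S hS
  induction hS using Submodule.span_induction with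
  | mem S hS =>
    obtain ⟨A, hA, a, ha, B, hB, rfl⟩ := hS
    exact tracePairing_eq_zero_of_mem_ran
      (fun f hf h => tracePairing_bimodule_theta hJ hA hB ha hf h) hk
  | zero => exact congrFun (map_zero tracePairingₗ) k
  | add S S' _ _ hS hS' =>
    simp only [Set.mem_ofPred_eq, tracePairing_add] at *
    rw [hS, hS', add_zero]
  | smul c S _ hS =>
    simp only [Set.mem_ofPred_eq, tracePairing_smul] at *
    rw [hS, mul_zero]

/-- The operator `λ_g M_{T_g}` carries exactly the entries of `T` with `y = gx`, so at `(x, y)` only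
`g = y x⁻¹` contributes. -/
theorem sum_diagonal_apply_single [DecidableEq G] (T : BEll2 G) {u : G → ℂ}
    (hu : (Function.support u).Finite) (x y : G) :
    (∑ g ∈ hu.toFinset, u g • (leftReg g * mulOp (diagonal T g))) (lp.single 2 x 1) y =
      u (y * x⁻¹) * T (lp.single 2 x 1) y := by
  have hg : ∀ g, (leftReg g * mulOp (diagonal T g)) (lp.single 2 x 1) y =
      if g = y * x⁻¹ then T (lp.single 2 x 1) y else 0 := by
    intro g
    split_ifs with h
    · subst h
      simp [diagonal_apply]
    · have : g⁻¹ * y ≠ x := fun h' => h (by rw [← h']; group)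
      simp [this]
  simp only [sum_apply, lp.coeFn_sum, Finset.sum_apply,
    smul_apply, lp.coeFn_smul, Pi.smul_apply, hg, smul_eq_mul]
  -- If `y x⁻¹` is outside the support, the sum is empty at this entry and `u(y x⁻¹) = 0`.
  simp +contextual

theorem traceAnnihilator_ran_subset (hG : WeaklyAmenable G) (J : Submodule ℂ (Ell1 G)) :
    traceAnnihilator (ran J) ⊆ (bim (annihilator J) : Set (BEll2 G)) := by
  classical
  intro T hT
  obtain ⟨ι, _, _, _, u, L, hL, hu, hlim⟩ := hG
  rw [bim, coe_weakStarClosure]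
  let S : ι → BEll2 G := fun i =>
    ∑ g ∈ (hu i).2.1.toFinset, u i g • (leftReg g * mulOp (diagonal T g))
  have hS : ∀ i x y, S i (lp.single 2 x 1) y = u i (y * x⁻¹) * T (lp.single 2 x 1) y :=
    fun i => sum_diagonal_apply_single T (hu i).2.1
  have hC : ∀ i, ‖S i‖ ≤ L * ‖T‖ := fun i => (hu i).2.2.norm_le hL.le (hS i)
  let _ := weakStarTopology G
  refine mem_closure_of_tendsto (f := S) (b := Filter.atTop) ?_ (Filter.Eventually.of_forall
    fun i => Submodule.sum_mem _ fun g _ => Submodule.smul_mem _ _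
      (leftReg_mul_mulOp_mem (diagonal_mem_annihilator hT g) g))
  -- Weak-* convergence is convergence of each trace pairing.
  rw [nhds_induced, Filter.tendsto_comap_iff, tendsto_pi_nhds]
  refine tendsto_tracePairing_of_bounded hC fun x y => ?_
  simp only [hS]
  simpa using (hlim (y * x⁻¹)).mul_const (T (lp.single 2 x 1) y)

end Group

end VNBimodule

end

theorem mainTheorem2 {G : Type*} [Group G] (hG : VNBimodule.WeaklyAmenable G)
    (J : Submodule ℂ (VNBimodule.Ell1 G)) (hJ : VNBimodule.IsClosedLeftIdeal J) :
    VNBimodule.traceAnnihilator (VNBimodule.ran J) =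
      (VNBimodule.bim (VNBimodule.annihilator J) : Set (VNBimodule.BEll2 G)) :=
  (VNBimodule.traceAnnihilator_ran_subset hG J).antisymm (VNBimodule.bim_annihilator_subset hJ)
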